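/- Let $\mathcal G=(\mathcal V,\mathcal E,W)$ be a strongly connected weighted digraph with vertex set $\mathcal V=\{1,\dots,n\}$ and nonnegative weighted adjacency matrix $W$ (there is an arc from $i$ to $j$ iff $W_{ij}>0$), and let $k$ be an integer with $2\le k\le n$. Put $d_i=\sum_j W_{ij}$, $d_{\mathcal G}=\sum_i d_i$ and $P_{ij}=W_{ij}/d_i$; let $\pi$ be the stationary distribution of the random walk on $\mathcal V$ with transition matrix $P$, and let $L=d_{\mathcal G}\,\mathrm{Diag}(\pi)(I-P)$ be the Laplacian of $\mathcal G$, with Moore–Penrose inverse $L^\dagger$. For a nonempty $\mathcal X\subseteq\mathcal V$ and $i\notin\mathcal X$ let $P_{\mathrm{es}}(i,\mathcal X)$ be the probability that the random walk started at $i$ reaches a vertex of $\mathcal X$ before it returns to $i$, and put $$\Omega(i,\mathcal X)=\frac1{d_{\mathcal G}\,\pi_i\,P_{\mathrm{es}}(i,\mathcal X)}\quad(i\notin\mathcal X),\qquad \Omega(i,\mathcal X)=0\quad(i\in\mathcal X),\qquad \Omega(\mathcal X)=\sum_{i\in\mathcal V}\Omega(i,\mathcal X),$$ and, for vertices, $\Omega(i,j)=\Omega(i,\{j\})$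 and $\Omega(v)=\sum_{j\in\mathcal V}\Omega(v,j)$. Write $L_{\setminus\mathcal X}$ for $L$ with the rows and columns of $\mathcal X$ removed. The greedy algorithm Exact, with input $L$ and $k$, selects $v_1\in\arg\min_{v\in\mathcal V}\bigl(n L^\dagger_{vv}+\mathrm{Tr}\,L^\dagger\bigr)$ and sets $\mathcal X=\{v_1\}$, $M=L_{\setminus\{v_1\}}^{-1}$. Then, for $i=2,\dots,k$, it selects $$v_i\in\arg\max_{v\in\mathcal V\setminus\mathcal X}\Delta(\mathcal X,v),\qquad \Delta(\mathcal X,v)=\frac{e_v^\top M^2e_v}{e_v^\top M e_v},$$ replaces $M$ by $M-\frac{M e_{v_i}e_{v_i}^\top M}{e_{v_i}^\top M e_{v_i}}$ with the row and column of $v_i$ removed, and adds $v_i$ to $\mathcal X$. Ties are broken arbitrarily. Finally it returns $\mathcal X$. **Theorem.** The algorithm can always be run to the end, and every set $\mathcal X$ that it can return satisfies $|\mathcal X|=k$ and $$\Omega(v^*)-\Omega(\mathcal X)\ \ge\ \Bigl(1-\frac{k}{k-1}\cdot\frac1e\Bigr)\bigl(\Omega(v^*)-\Omega(\mathcal X^*)\bigr),$$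 where $v^*$ is any vertex that minimizes $\Omega(v)$ over $v\in\mathcal V$, and $\mathcal X^*$ is any set that minimizes $\Omega$ over the $k$-element subsets of $\mathcal V$, or over the nonempty subsets of $\mathcal V$ with at most $k$ elements. -/

import Mathlib

open MeasureTheory ProbabilityTheory

/-- The Moore-Penrose conditions: `B` is the pseudoinverse of the real square matrix `A`. -/
def IsMoorePenrose {n : ℕ} (A B : Matrix (Fin n) (Fin n) ℝ) : Prop :=
  A * B * A = A ∧ B * A * B = B ∧ (A * B).transpose = A * B ∧ (B * A).transpose = B * A

open Classical in
/-- The Moore-Penrose inverse of a real square matrix, i.e. the matrix that satisfies the four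
Moore-Penrose conditions. -/
noncomputable def pinv {n : ℕ} (A : Matrix (Fin n) (Fin n) ℝ) : Matrix (Fin n) (Fin n) ℝ :=
  if h : ∃ B, IsMoorePenrose A B then h.choose else 0

/-- A weighted digraph on the vertices `0, …, n - 1`, given by its nonnegative weighted adjacency
matrix; there is an arc from `i` to `j` exactly when `W i j` is positive. -/
structure WeightedDigraph (n : ℕ) where
  W : Matrix (Fin n) (Fin n) ℝ
  nonneg : ∀ i j, 0 ≤ W i j

namespace WeightedDigraph

variable {n : ℕ} (G : WeightedDigraph n)

/-- There is an arc from `i` to `j`. -/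
def Adj (i j : Fin n) : Prop := 0 < G.W i j

/-- Every vertex is reachable from every vertex along arcs. -/
def StronglyConnected : Prop := ∀ i j, Relation.ReflTransGen G.Adj i j

/-- The (out-)degree of a vertex. -/
noncomputable def deg (i : Fin n) : ℝ := ∑ j, G.W i j

/-- The volume of the digraph. -/
noncomputable def vol : ℝ := ∑ i, G.deg i

/-- The transition matrix of the random walk. -/
noncomputable def P : Matrix (Fin n) (Fin n) ℝ := Matrix.of fun i j => G.W i j / G.deg i

open Classical in
/-- The stationary distribution of the random walk: the probability vector `p` with `pᵀ P = pᵀ`. -/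
noncomputable def stationary : Fin n → ℝ :=
  if h : ∃ p : Fin n → ℝ, p ∈ stdSimplex ℝ (Fin n) ∧ Matrix.vecMul p G.P = p
  then h.choose else 0

theorem sum_ofReal_P {i : Fin n} (h : G.deg i ≠ 0) : ∑ j, ENNReal.ofReal (G.P i j) = 1 := by
  have h0 : 0 ≤ G.deg i := Finset.sum_nonneg fun j _ => G.nonneg i j
  have h1 : ∀ j ∈ Finset.univ, 0 ≤ G.P i j := fun j _ => div_nonneg (G.nonneg i j) h0
  have h2 : ∑ j, G.P i j = 1 := by
    simp only [P, Matrix.of_apply]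
    rw [← Finset.sum_div]
    exact div_self h
  rw [← ENNReal.ofReal_sum_of_nonneg h1, h2, ENNReal.ofReal_one]

open Classical in
/-- The law of one jump from `i`: the walk moves to `j` with probability `P i j`. (A vertex without
outgoing arcs, which a strongly connected digraph with two or more vertices does not have, is made
absorbing.) -/
noncomputable def stepLaw (i : Fin n) : PMF (Fin n) :=
  if h : G.deg i ≠ 0 then PMF.ofFintype (fun j => ENNReal.ofReal (G.P i j)) (G.sum_ofReal_P h)
  else PMF.pure i

/-- The one-step Markov kernel of the random walk. -/
noncomputable def stepKernel : Kernel (Fin n) (Fin n) :=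
  Kernel.ofFunOfCountable fun i => (G.stepLaw i).toMeasure

instance : IsMarkovKernel G.stepKernel :=
  ⟨fun i => by
    change IsProbabilityMeasure (G.stepLaw i).toMeasure
    infer_instance⟩

/-- The transition from the history `x 0, …, x t` to `x (t + 1)`: it depends only on `x t`. -/
noncomputable def historyKernel (t : ℕ) :
    Kernel ((s : Finset.Iic t) → (fun _ : ℕ => Fin n) s) ((fun _ : ℕ => Fin n) (t + 1)) :=
  G.stepKernel.comap (fun x => x ⟨t, Finset.mem_Iic.2 le_rfl⟩) (measurable_pi_apply _)

instance (t : ℕ) : IsMarkovKernel (G.historyKernel t) := by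
  unfold historyKernel
  infer_instance

/-- The law, on the space of trajectories `ℕ → Fin n`, of the random walk started at `i`. -/
noncomputable def walkLaw (i : Fin n) : Measure (ℕ → Fin n) :=
  Kernel.trajMeasure (X := fun _ => Fin n) (Measure.dirac i) G.historyKernel

/-- The escape probability from `i` to `X`: the probability that the random walk started at `i`
reaches some vertex of `X` before it returns to `i`. -/
noncomputable def escapeProb (i : Fin n) (X : Finset (Fin n)) : ℝ :=
  (G.walkLaw i).real {w | ∃ t, 1 ≤ t ∧ w t ∈ X ∧ ∀ s, 1 ≤ s → s < t → w s ≠ i}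

/-- The resistance distance between two vertices. -/
noncomputable def resistance (i j : Fin n) : ℝ :=
  if i = j then 0 else 1 / (G.vol * G.stationary i * G.escapeProb i {j})

/-- The resistance distance of a vertex. -/
noncomputable def vertexResistance (i : Fin n) : ℝ := ∑ j, G.resistance i j

/-- The resistance distance between a vertex and a nonempty vertex group; it is zero for the
vertices of the group. -/
noncomputable def resistanceTo (i : Fin n) (X : Finset (Fin n)) : ℝ :=
  if i ∈ X then 0 else 1 / (G.vol * G.stationary i * G.escapeProb i X)

/-- The resistance distance of a nonempty vertex group. -/
noncomputable def groupResistance (X : Finset (Fin n)) : ℝ := ∑ i, G.resistanceTo i X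

/-- The Laplacian matrix of a digraph. -/
noncomputable def laplacian : Matrix (Fin n) (Fin n) ℝ :=
  G.vol • (Matrix.diagonal G.stationary * (1 - G.P))

end WeightedDigraph

namespace Exact

variable {n : ℕ}

/-- `A` with the rows and columns of the vertices in `X` removed. -/
def removed (A : Matrix (Fin n) (Fin n) ℝ) (X : Finset (Fin n)) :
    Matrix {u // u ∉ X} {u // u ∉ X} ℝ :=
  A.submatrix Subtype.val Subtype.val

/-- The marginal gain `Δ(X, v)`, as the algorithm evaluates it from the maintained matrix `M`, which
stands for the inverse of the Laplacian with the rows and columns of `X` removed. -/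
noncomputable def gain {X : Finset (Fin n)} (M : Matrix {u // u ∉ X} {u // u ∉ X} ℝ)
    (v : {u // u ∉ X}) : ℝ :=
  (M * M) v v / M v v

/-- The update of the maintained matrix when `v` is added to `X`: the rank-one correction
`M - (M e_v e_vᵀ M) / (e_vᵀ M e_v)`, from which the row and column of `v` are removed. -/
noncomputable def update {X : Finset (Fin n)} (M : Matrix {u // u ∉ X} {u // u ∉ X} ℝ)
    (v : {u // u ∉ X}) : Matrix {u // u ∉ insert v.1 X} {u // u ∉ insert v.1 X} ℝ :=
  Matrix.of fun a b =>
    let a' : {u // u ∉ X} := ⟨a.1, fun h => a.2 (Finset.mem_insert_of_mem h)⟩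
    let b' : {u // u ∉ X} := ⟨b.1, fun h => b.2 (Finset.mem_insert_of_mem h)⟩
    M a' b' - M a' v * M v b' / M v v

/-- `State L i X M`: with input the matrix `L`, the algorithm can hold the set `X` and the matrix
`M` after `i` vertices have been selected. Ties in the `argmin` of the first selection and in the
`argmax` of the later ones may be broken in any way. -/
inductive State (L : Matrix (Fin n) (Fin n) ℝ) :
    ℕ → (X : Finset (Fin n)) → Matrix {u // u ∉ X} {u // u ∉ X} ℝ → Prop
  | init (v : Fin n)
      (hv : ∀ u, n * pinv L v v + (pinv L).trace ≤ n * pinv L u u + (pinv L).trace) :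
      State L 1 {v} (removed L {v})⁻¹
  | step {i : ℕ} {X : Finset (Fin n)} {M : Matrix {u // u ∉ X} {u // u ∉ X} ℝ}
      (h : State L i X M) (v : {u // u ∉ X}) (hv : ∀ u, gain M u ≤ gain M v) :
      State L (i + 1) (insert v.1 X) (update M v)

/-- The algorithm, run with input the matrix `L` and the number `k`, can return the set `X`. -/
def Returns (L : Matrix (Fin n) (Fin n) ℝ) (k : ℕ) (X : Finset (Fin n)) : Prop :=
  ∃ M, State L k X M

end Exact

/-! Everything is expressed through the Green function `green X`, the inverse of the Laplacian with
`X` removed, extended by zero. The Laplacian need not be symmetric; what replaces positive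
definiteness is the minimum principle, which makes `green X` well defined, unique and entrywise
nonnegative.

Probability enters once. The function `1 - green X j i / green X i i` of `j` is one on `X`, zero at
`i` and harmonic elsewhere, so its mean after one step from `i` is the escape probability. This
gives Ω(i, X) = `green X i i`, and Ω(X) is the trace of the inverse. For a single vertex `v` both
Ω(v) and Ω({v}) equal n L†_vv + Tr L†, so the first selection is optimal among singletons.

Adding `v` to `X` is a rank-one (Schur complement) correction of `green X`. Hence the maintained
matrix stays the true inverse and `gain` is the exact decrease of Ω, a sum over `i` of `green X v i`
times `green X i v / green X v v`. Both factors are nonnegative and can only shrink as `X` grows, so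
Ω is nonincreasing and supermodular on nonempty sets. The usual greedy argument contracts the gap to
the optimum by 1 - 1/k in each of the k - 1 later steps, and (1 - 1/k)^(k-1) ≤ (k/(k-1))/e. -/

namespace WeightedDigraph

variable {n : ℕ} {G : WeightedDigraph n}

/-! ### Transition matrix, stationary distribution and Laplacian -/

theorem StronglyConnected.deg_pos (hG : G.StronglyConnected) (hn : 2 ≤ n) (i : Fin n) :
    0 < G.deg i := by
  have : Nontrivial (Fin n) := Fin.nontrivial_iff_two_le.2 hn
  obtain ⟨j, hj⟩ := exists_ne i
  rcases (hG i j).cases_head with h | ⟨c, hc, -⟩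
  · exact absurd h.symm hj
  · exact Finset.sum_pos' (fun j _ => G.nonneg i j) ⟨c, Finset.mem_univ _, hc⟩

theorem deg_nonneg (i : Fin n) : 0 ≤ G.deg i :=
  Finset.sum_nonneg fun j _ => G.nonneg i j

theorem P_nonneg (i j : Fin n) : 0 ≤ G.P i j :=
  div_nonneg (G.nonneg i j) (G.deg_nonneg i)

theorem StronglyConnected.sum_P (hG : G.StronglyConnected) (hn : 2 ≤ n) (i : Fin n) :
    ∑ j, G.P i j = 1 := by
  simp only [P, Matrix.of_apply]
  rw [← Finset.sum_div]
  exact div_self (hG.deg_pos hn i).ne'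

theorem StronglyConnected.P_pos (hG : G.StronglyConnected) (hn : 2 ≤ n) {i j : Fin n}
    (h : G.Adj i j) : 0 < G.P i j :=
  div_pos h (hG.deg_pos hn i)

theorem StronglyConnected.vol_pos (hG : G.StronglyConnected) (hn : 2 ≤ n) : 0 < G.vol :=
  Finset.sum_pos (fun i _ => hG.deg_pos hn i) ⟨⟨0, by omega⟩, Finset.mem_univ _⟩

/-- Unit row sums make `1 - P` singular, hence there is a left fixed vector `x`. The triangle
inequality gives |x| ≤ |x|P entrywise, and both sides have the same total, so |x| is itself fixed
and can be normalized. -/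
theorem StronglyConnected.exists_stationary (hG : G.StronglyConnected) (hn : 2 ≤ n) :
    ∃ p : Fin n → ℝ, p ∈ stdSimplex ℝ (Fin n) ∧ Matrix.vecMul p G.P = p := by
  have hdet : (1 - G.P).det = 0 := by
    refine Matrix.exists_mulVec_eq_zero_iff.1 ⟨fun _ => 1, ?_, ?_⟩
    · intro h
      simpa using congrFun h ⟨0, by omega⟩
    · ext i
      simp [Matrix.mulVec, dotProduct, hG.sum_P hn i, Matrix.one_apply]
  obtain ⟨x, hx0, hx⟩ := Matrix.exists_vecMul_eq_zero_iff.2 hdet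
  have hx' : ∀ j, ∑ i, x i * G.P i j = x j := fun j => by
    have := congrFun hx j
    simp only [Matrix.vecMul_sub, Matrix.vecMul_one, Pi.sub_apply, Pi.zero_apply] at this
    simp only [Matrix.vecMul, dotProduct] at this
    linarith
  have hle : ∀ j ∈ Finset.univ, |x j| ≤ ∑ i, |x i| * G.P i j := fun j _ => by
    calc |x j| = |∑ i, x i * G.P i j| := by rw [hx']
      _ ≤ ∑ i, |x i * G.P i j| := Finset.abs_sum_le_sum_abs _ _
      _ = ∑ i, |x i| * G.P i j := by simp only [abs_mul, abs_of_nonneg (P_nonneg _ _)]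
  have hsum : ∑ j, |x j| = ∑ j, ∑ i, |x i| * G.P i j := by
    rw [Finset.sum_comm]
    simp only [← Finset.mul_sum, hG.sum_P hn, mul_one]
  have heq := (Finset.sum_eq_sum_iff_of_le hle).1 hsum
  have hpos : 0 < ∑ j, |x j| := by
    obtain ⟨i, hi⟩ := Function.ne_iff.1 hx0
    exact Finset.sum_pos' (fun _ _ => abs_nonneg _) ⟨i, Finset.mem_univ _, abs_pos.2 hi⟩
  refine ⟨fun i => |x i| / ∑ j, |x j|, ⟨fun i => by positivity, ?_⟩, ?_⟩
  · rw [← Finset.sum_div]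
    exact div_self hpos.ne'
  · ext j
    simp only [Matrix.vecMul, dotProduct]
    rw [heq j (Finset.mem_univ _), Finset.sum_div]
    exact Finset.sum_congr rfl fun i _ => by ring

theorem StronglyConnected.stationary_spec (hG : G.StronglyConnected) (hn : 2 ≤ n) :
    G.stationary ∈ stdSimplex ℝ (Fin n) ∧ Matrix.vecMul G.stationary G.P = G.stationary := by
  have h := hG.exists_stationary hn
  rw [stationary, dif_pos h]
  exact h.choose_spec

theorem StronglyConnected.sum_stationary_mul_P (hG : G.StronglyConnected) (hn : 2 ≤ n)
    (j : Fin n) : ∑ i, G.stationary i * G.P i j = G.stationary j :=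
  congrFun (hG.stationary_spec hn).2 j

theorem StronglyConnected.stationary_pos (hG : G.StronglyConnected) (hn : 2 ≤ n) (i : Fin n) :
    0 < G.stationary i := by
  obtain ⟨⟨h0, h1⟩, -⟩ := hG.stationary_spec hn
  obtain ⟨a, -, ha⟩ : ∃ a ∈ Finset.univ, 0 < G.stationary a :=
    Finset.exists_lt_of_sum_lt (f := fun _ => (0 : ℝ)) (by simp [h1])
  -- Positive mass at one vertex spreads along arcs by stationarity.
  induction hG a i with
  | refl => exact ha
  | @tail b c _ hbc hb =>
    rw [← hG.sum_stationary_mul_P hn c]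
    exact Finset.sum_pos' (fun i _ => mul_nonneg (h0 i) (P_nonneg _ _))
      ⟨b, Finset.mem_univ _, mul_pos hb (hG.P_pos hn hbc)⟩

theorem laplacian_apply (i j : Fin n) :
    G.laplacian i j = G.vol * G.stationary i * ((1 : Matrix (Fin n) (Fin n) ℝ) i j - G.P i j) := by
  simp [laplacian, Matrix.diagonal_mul, mul_assoc]

theorem sum_laplacian_mul (x : Fin n → ℝ) (i : Fin n) :
    ∑ j, G.laplacian i j * x j = G.vol * G.stationary i * (x i - ∑ j, G.P i j * x j) := by
  simp only [laplacian_apply, mul_assoc, ← Finset.mul_sum, sub_mul, Finset.sum_sub_distrib]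
  simp [Matrix.one_apply]

theorem StronglyConnected.laplacian_row_sum (hG : G.StronglyConnected) (hn : 2 ≤ n) (i : Fin n) :
    ∑ j, G.laplacian i j = 0 := by
  have := G.sum_laplacian_mul (fun _ => 1) i
  simpa [hG.sum_P hn] using this

theorem StronglyConnected.laplacian_col_sum (hG : G.StronglyConnected) (hn : 2 ≤ n) (j : Fin n) :
    ∑ i, G.laplacian i j = 0 := by
  simp only [laplacian_apply, mul_sub, Finset.sum_sub_distrib, mul_assoc, ← Finset.mul_sum,
    hG.sum_stationary_mul_P hn]
  simp [Matrix.one_apply]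

/-! ### Minimum principle and Green function -/

/-- The minimum principle for functions superharmonic off `X`. -/
theorem StronglyConnected.nonneg_of_superharmonic (hG : G.StronglyConnected) (hn : 2 ≤ n)
    {X : Finset (Fin n)} (hX : X.Nonempty) {x : Fin n → ℝ} (hx : ∀ i ∈ X, 0 ≤ x i)
    (h : ∀ i ∉ X, 0 ≤ ∑ j, G.laplacian i j * x j) (i : Fin n) : 0 ≤ x i := by
  have : Nonempty (Fin n) := ⟨i⟩
  obtain ⟨m, hm⟩ := Finite.exists_min x
  by_contra! hi
  have hm0 : x m < 0 := (hm i).trans_lt hi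
  obtain ⟨a, ha⟩ := hX
  -- A negative minimum is attained off `X`, where the value is at least the mean over the
  -- successors; so all successors attain it too, and strong connectivity carries it into `X`, a
  -- contradiction.
  have key : ∀ j, Relation.ReflTransGen G.Adj m j → x j = x m := fun j hj => by
    induction hj with
    | refl => rfl
    | @tail b c _ hbc hb =>
      have hbX : b ∉ X := fun hbX => by linarith [hx b hbX]
      have h1 := h b hbX
      rw [sum_laplacian_mul] at h1
      have h2 := (mul_nonneg_iff_of_pos_left
        (mul_pos (hG.vol_pos hn) (hG.stationary_pos hn b))).1 h1
      have h3 : ∑ j, G.P b j * (x j - x m) ≤ 0 := by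
        simp only [mul_sub, Finset.sum_sub_distrib, ← Finset.sum_mul, hG.sum_P hn]
        linarith
      have hnn : ∀ j ∈ Finset.univ, 0 ≤ G.P b j * (x j - x m) := fun j _ =>
        mul_nonneg (P_nonneg _ _) (sub_nonneg.2 (hm j))
      have h4 := (Finset.sum_eq_zero_iff_of_nonneg hnn).1
        (le_antisymm h3 (Finset.sum_nonneg hnn)) c (Finset.mem_univ _)
      rcases mul_eq_zero.1 h4 with h5 | h5
      · exact absurd h5 (hG.P_pos hn hbc).ne'
      · linarith
  linarith [hx a ha, key a (hG m a)]

theorem StronglyConnected.eq_zero_of_harmonic (hG : G.StronglyConnected) (hn : 2 ≤ n)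
    {X : Finset (Fin n)} (hX : X.Nonempty) {x : Fin n → ℝ} (hx : ∀ i ∈ X, x i = 0)
    (h : ∀ i ∉ X, ∑ j, G.laplacian i j * x j = 0) (i : Fin n) : x i = 0 := by
  refine le_antisymm ?_ (hG.nonneg_of_superharmonic hn hX (fun i hi => (hx i hi).ge)
    (fun i hi => (h i hi).ge) i)
  refine neg_nonneg.1 (hG.nonneg_of_superharmonic hn hX (x := fun i => - x i)
    (fun i hi => by simp [hx i hi]) (fun i hi => ?_) i)
  simp [h i hi]

variable (G) in
/-- The inverse of the Laplacian with the rows and columns of `X` removed, extended by zero. -/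
noncomputable def green (X : Finset (Fin n)) (i j : Fin n) : ℝ :=
  if h : i ∉ X ∧ j ∉ X then (Exact.removed G.laplacian X)⁻¹ ⟨i, h.1⟩ ⟨j, h.2⟩ else 0

theorem green_apply {X : Finset (Fin n)} (i j : {u // u ∉ X}) :
    G.green X i j = (Exact.removed G.laplacian X)⁻¹ i j := by
  rw [green, dif_pos ⟨i.2, j.2⟩]

theorem green_of_mem_left {X : Finset (Fin n)} {i : Fin n} (h : i ∈ X) (j : Fin n) :
    G.green X i j = 0 :=
  dif_neg fun h' => h'.1 h

theorem green_of_mem_right {X : Finset (Fin n)} (i : Fin n) {j : Fin n} (h : j ∈ X) :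
    G.green X i j = 0 :=
  dif_neg fun h' => h'.2 h

theorem sum_notMem_eq {X : Finset (Fin n)} (f : Fin n → ℝ) (hf : ∀ i ∈ X, f i = 0) :
    ∑ u : {u // u ∉ X}, f u = ∑ i, f i := by
  rw [← Fintype.sum_subtype_add_sum_subtype (fun i => i ∈ X) f,
    Finset.sum_eq_zero (fun (u : {u // u ∈ X}) _ => hf u u.2), zero_add]

/-- A null vector, extended by zero, is harmonic off `X` and vanishes on `X`. -/
theorem StronglyConnected.isUnit_det_removed (hG : G.StronglyConnected) (hn : 2 ≤ n)
    {X : Finset (Fin n)} (hX : X.Nonempty) : IsUnit (Exact.removed G.laplacian X).det := by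
  rw [isUnit_iff_ne_zero]
  intro h0
  obtain ⟨v, hv, hv0⟩ := Matrix.exists_mulVec_eq_zero_iff.2 h0
  apply hv
  let x : Fin n → ℝ := fun i => if h : i ∉ X then v ⟨i, h⟩ else 0
  have hxX : ∀ i ∈ X, x i = 0 := fun i hi => by simp [x, hi]
  have hxv : ∀ u : {u // u ∉ X}, x u = v u := fun u => dif_pos u.2
  have key := hG.eq_zero_of_harmonic hn hX hxX fun i hi => by
    rw [← sum_notMem_eq (X := X) _ fun j hj => by rw [hxX j hj, mul_zero]]
    simp only [hxv]
    exact congrFun hv0 ⟨i, hi⟩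
  ext u
  rw [← hxv, key, Pi.zero_apply]

theorem StronglyConnected.laplacian_mul_green (hG : G.StronglyConnected) (hn : 2 ≤ n)
    {X : Finset (Fin n)} (hX : X.Nonempty) {a b : Fin n} (ha : a ∉ X) (hb : b ∉ X) :
    ∑ j, G.laplacian a j * G.green X j b = if a = b then 1 else 0 := by
  rw [← sum_notMem_eq (X := X) _ fun j hj => by rw [green_of_mem_left hj, mul_zero]]
  have := congrFun (congrFun (Matrix.mul_nonsing_inv _ (hG.isUnit_det_removed hn hX)) ⟨a, ha⟩)
    ⟨b, hb⟩
  simp only [Matrix.mul_apply, Matrix.one_apply, Subtype.mk.injEq] at this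
  rw [← this]
  exact Finset.sum_congr rfl fun u _ => by rw [← green_apply u ⟨b, hb⟩]; rfl

/-- A column of the Green function is determined by its Laplacian. -/
theorem StronglyConnected.green_unique (hG : G.StronglyConnected) (hn : 2 ≤ n)
    {X : Finset (Fin n)} (hX : X.Nonempty) {b : Fin n} (hb : b ∉ X) {x : Fin n → ℝ}
    (hx : ∀ i ∈ X, x i = 0)
    (h : ∀ a ∉ X, ∑ j, G.laplacian a j * x j = if a = b then 1 else 0) (i : Fin n) :
    G.green X i b = x i := by
  refine sub_eq_zero.1 (hG.eq_zero_of_harmonic hn hX (x := fun i => G.green X i b - x i)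
    (fun i hi => by rw [green_of_mem_left hi, hx i hi, sub_zero]) (fun a ha => ?_) i)
  simp only [mul_sub, Finset.sum_sub_distrib, h a ha, hG.laplacian_mul_green hn hX ha hb, sub_self]

theorem StronglyConnected.green_nonneg (hG : G.StronglyConnected) (hn : 2 ≤ n)
    {X : Finset (Fin n)} (hX : X.Nonempty) (i j : Fin n) : 0 ≤ G.green X i j := by
  by_cases hj : j ∈ X
  · rw [green_of_mem_right i hj]
  · refine hG.nonneg_of_superharmonic hn hX (x := fun i => G.green X i j)
      (fun i hi => (green_of_mem_left hi j).ge) (fun a ha => ?_) i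
    rw [hG.laplacian_mul_green hn hX ha hj]
    split_ifs <;> norm_num

theorem StronglyConnected.green_self_pos (hG : G.StronglyConnected) (hn : 2 ≤ n)
    {X : Finset (Fin n)} (hX : X.Nonempty) {i : Fin n} (hi : i ∉ X) : 0 < G.green X i i := by
  refine (hG.green_nonneg hn hX i i).lt_of_ne' fun h0 => ?_
  have h1 := hG.laplacian_mul_green hn hX hi hi
  rw [sum_laplacian_mul, h0, if_pos rfl] at h1
  have h2 : 0 ≤ ∑ j, G.P i j * G.green X j i :=
    Finset.sum_nonneg fun j _ => mul_nonneg (P_nonneg _ _) (hG.green_nonneg hn hX j i)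
  have h3 := mul_nonneg (mul_pos (hG.vol_pos hn) (hG.stationary_pos hn i)).le h2
  linarith

/-- By uniqueness: the right side vanishes on `X` and at `v`, and the Laplacian of the correction
is, off `X`, concentrated at `v`, so it is not seen outside `insert v X`. -/
theorem StronglyConnected.green_insert (hG : G.StronglyConnected) (hn : 2 ≤ n)
    {X : Finset (Fin n)} (hX : X.Nonempty) {v : Fin n} (hv : v ∉ X) (i j : Fin n) :
    G.green (insert v X) i j =
      G.green X i j - G.green X i v * G.green X v j / G.green X v v := by
  have hvv := (hG.green_self_pos hn hX hv).ne'
  by_cases hjX : j ∈ X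
  · simp [green_of_mem_right _ hjX, green_of_mem_right i (Finset.mem_insert_of_mem hjX)]
  by_cases hjv : j = v
  · subst hjv
    rw [green_of_mem_right i (Finset.mem_insert_self _ _)]
    field_simp
    ring
  refine hG.green_unique hn (Finset.insert_nonempty _ _) (by simp [hjX, hjv])
    (x := fun i => G.green X i j - G.green X i v * G.green X v j / G.green X v v)
    (fun i hi => ?_) (fun a ha => ?_) i
  · rcases Finset.mem_insert.1 hi with rfl | hi
    · field_simp
      ring
    · simp [green_of_mem_left hi]
  · rw [Finset.mem_insert, not_or] at ha
    have h1 : ∀ l, G.laplacian a l * (G.green X l j - G.green X l v * G.green X v j / G.green X v v)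
        = G.laplacian a l * G.green X l j
          - G.laplacian a l * G.green X l v * (G.green X v j / G.green X v v) := fun l => by ring
    simp only [h1, Finset.sum_sub_distrib, ← Finset.sum_mul,
      hG.laplacian_mul_green hn hX ha.2 hjX, hG.laplacian_mul_green hn hX ha.2 hv, if_neg ha.1,
      zero_mul, sub_zero]

theorem StronglyConnected.green_insert_le (hG : G.StronglyConnected) (hn : 2 ≤ n)
    {X : Finset (Fin n)} (hX : X.Nonempty) (v i j : Fin n) :
    G.green (insert v X) i j ≤ G.green X i j := by
  by_cases hv : v ∈ X
  · rw [Finset.insert_eq_of_mem hv]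
  · rw [hG.green_insert hn hX hv]
    have := hG.green_nonneg hn hX
    exact sub_le_self _ (div_nonneg (mul_nonneg (this _ _) (this _ _)) (this _ _))

/-- The inverse of the removed Laplacian is updated by the rank-one correction. -/
theorem StronglyConnected.update_inv_removed (hG : G.StronglyConnected) (hn : 2 ≤ n)
    {X : Finset (Fin n)} (hX : X.Nonempty) (v : {u // u ∉ X}) :
    Exact.update (Exact.removed G.laplacian X)⁻¹ v =
      (Exact.removed G.laplacian (insert v.1 X))⁻¹ := by
  ext a b
  rw [← green_apply, hG.green_insert hn hX v.2]
  simp only [Exact.update, Matrix.of_apply, ← green_apply]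

theorem gain_inv_removed {X : Finset (Fin n)} (v : {u // u ∉ X}) :
    Exact.gain (Exact.removed G.laplacian X)⁻¹ v =
      (∑ i, G.green X v i * G.green X i v) / G.green X v v := by
  rw [← sum_notMem_eq (X := X) _ fun j hj => by rw [green_of_mem_left hj, mul_zero]]
  simp only [Exact.gain, Matrix.mul_apply, ← green_apply]

/-! ### The pseudoinverse and single vertices -/

variable (n) in
/-- The matrix of the orthogonal projection onto the constant vectors. -/
noncomputable def avg : Matrix (Fin n) (Fin n) ℝ := Matrix.of fun _ _ => (n : ℝ)⁻¹

theorem avg_mul (A : Matrix (Fin n) (Fin n) ℝ) (i j : Fin n) :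
    (avg n * A) i j = (n : ℝ)⁻¹ * ∑ l, A l j := by
  simp [avg, Matrix.mul_apply, Finset.mul_sum]

theorem mul_avg (A : Matrix (Fin n) (Fin n) ℝ) (i j : Fin n) :
    (A * avg n) i j = (∑ l, A i l) * (n : ℝ)⁻¹ := by
  simp [avg, Matrix.mul_apply, Finset.sum_mul]

theorem avg_mul_avg : avg n * avg n = avg n := by
  ext i j
  have hn : (n : ℝ) ≠ 0 := by
    have := i.pos
    positivity
  rw [avg_mul]
  simp [avg, hn]

theorem avg_transpose : (avg n).transpose = avg n := rfl

theorem StronglyConnected.avg_mul_laplacian (hG : G.StronglyConnected) (hn : 2 ≤ n) :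
    avg n * G.laplacian = 0 := by
  ext i j
  rw [avg_mul, hG.laplacian_col_sum hn]
  simp

theorem StronglyConnected.laplacian_mul_avg (hG : G.StronglyConnected) (hn : 2 ≤ n) :
    G.laplacian * avg n = 0 := by
  ext i j
  rw [mul_avg, hG.laplacian_row_sum hn]
  simp

/-- Only constant functions are harmonic. -/
theorem StronglyConnected.eq_of_laplacian_mulVec_eq_zero (hG : G.StronglyConnected) (hn : 2 ≤ n)
    {x : Fin n → ℝ} (h : G.laplacian.mulVec x = 0) (i j : Fin n) : x i = x j := by
  refine sub_eq_zero.1 (hG.eq_zero_of_harmonic hn (Finset.singleton_nonempty j)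
    (x := fun i => x i - x j) (fun a ha => ?_) (fun a _ => ?_) i)
  · rw [Finset.mem_singleton.1 ha, sub_self]
  · simp only [mul_sub, Finset.sum_sub_distrib, ← Finset.sum_mul, hG.laplacian_row_sum hn,
      zero_mul, sub_zero]
    exact congrFun h a

theorem StronglyConnected.isUnit_det_laplacian_add_avg (hG : G.StronglyConnected) (hn : 2 ≤ n) :
    IsUnit (G.laplacian + avg n).det := by
  rw [isUnit_iff_ne_zero]
  intro h0
  obtain ⟨x, hx, hx0⟩ := Matrix.exists_mulVec_eq_zero_iff.2 h0
  have h1 : (avg n).mulVec x = 0 := by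
    have := congrArg (avg n).mulVec hx0
    rwa [Matrix.mulVec_mulVec, mul_add, hG.avg_mul_laplacian hn, zero_add, avg_mul_avg,
      Matrix.mulVec_zero] at this
  rw [Matrix.add_mulVec, h1, add_zero] at hx0
  apply hx
  ext i
  have h2 : (n : ℝ)⁻¹ * ∑ j, x j = 0 := by
    simpa [avg, Matrix.mulVec, dotProduct, Finset.mul_sum] using congrFun h1 i
  have hn0 : (n : ℝ) ≠ 0 := by positivity
  simpa [hG.eq_of_laplacian_mulVec_eq_zero hn hx0 _ i, hn0] using h2

theorem StronglyConnected.exists_isMoorePenrose (hG : G.StronglyConnected) (hn : 2 ≤ n) :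
    ∃ B, IsMoorePenrose G.laplacian B ∧ G.laplacian * B = 1 - avg n ∧
      B * G.laplacian = 1 - avg n := by
  have hu := hG.isUnit_det_laplacian_add_avg hn
  -- Left and right null vectors of the Laplacian are both the constants, so L + J/n is invertible
  -- (J the all-ones matrix) and L† = (L + J/n)⁻¹ - J/n.
  set C := (G.laplacian + avg n)⁻¹ with hC
  have h1 : (G.laplacian + avg n) * C = 1 := Matrix.mul_nonsing_inv _ hu
  have h2 : C * (G.laplacian + avg n) = 1 := Matrix.nonsing_inv_mul _ hu
  have hJC : avg n * C = avg n := by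
    calc avg n * C = avg n * (G.laplacian + avg n) * C := by
          rw [mul_add, hG.avg_mul_laplacian hn, zero_add, avg_mul_avg]
      _ = avg n := by rw [mul_assoc, h1, mul_one]
  have hCJ : C * avg n = avg n := by
    calc C * avg n = C * ((G.laplacian + avg n) * avg n) := by
          rw [add_mul, hG.laplacian_mul_avg hn, zero_add, avg_mul_avg]
      _ = avg n := by rw [← mul_assoc, h2, one_mul]
  rw [add_mul, hJC] at h1
  rw [mul_add, hCJ] at h2
  have hLB : G.laplacian * (C - avg n) = 1 - avg n := by
    rw [mul_sub, hG.laplacian_mul_avg hn, sub_zero, ← h1, add_sub_cancel_right]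
  have hBL : (C - avg n) * G.laplacian = 1 - avg n := by
    rw [sub_mul, hG.avg_mul_laplacian hn, sub_zero, ← h2, add_sub_cancel_right]
  refine ⟨C - avg n, ⟨?_, ?_, ?_, ?_⟩, hLB, hBL⟩
  · rw [hLB, sub_mul, one_mul, hG.avg_mul_laplacian hn, sub_zero]
  · rw [hBL, sub_mul, one_mul, mul_sub, hJC, avg_mul_avg, sub_self, sub_zero]
  · rw [hLB, Matrix.transpose_sub, Matrix.transpose_one, avg_transpose]
  · rw [hBL, Matrix.transpose_sub, Matrix.transpose_one, avg_transpose]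

theorem _root_.IsMoorePenrose.unique {A B C : Matrix (Fin n) (Fin n) ℝ} (hB : IsMoorePenrose A B)
    (hC : IsMoorePenrose A C) : B = C := by
  obtain ⟨b1, b2, b3, b4⟩ := hB
  obtain ⟨c1, c2, c3, c4⟩ := hC
  have h1 : A * B = A * C := by
    calc A * B = (A * B).transpose := b3.symm
      _ = (A * C * (A * B)).transpose := by rw [← mul_assoc, c1]
      _ = A * B * (A * C) := by rw [Matrix.transpose_mul, b3, c3]
      _ = A * C := by rw [← mul_assoc, b1]
  have h2 : B * A = C * A := by
    calc B * A = (B * A).transpose := b4.symm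
      _ = (B * A * (C * A)).transpose := by rw [mul_assoc B, ← mul_assoc A, c1]
      _ = C * A * (B * A) := by rw [Matrix.transpose_mul, b4, c4]
      _ = C * A := by rw [mul_assoc, ← mul_assoc A, b1]
  calc B = B * A * B := b2.symm
    _ = C * (A * B) := by rw [h2, mul_assoc]
    _ = C := by rw [h1, ← mul_assoc, c2]

theorem StronglyConnected.pinv_spec (hG : G.StronglyConnected) (hn : 2 ≤ n) :
    IsMoorePenrose G.laplacian (pinv G.laplacian) ∧
      G.laplacian * pinv G.laplacian = 1 - avg n ∧
      pinv G.laplacian * G.laplacian = 1 - avg n := by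
  obtain ⟨B, hB, h1, h2⟩ := hG.exists_isMoorePenrose hn
  have h : ∃ B, IsMoorePenrose G.laplacian B := ⟨B, hB⟩
  have h3 : IsMoorePenrose G.laplacian (pinv G.laplacian) := by
    rw [pinv, dif_pos h]
    exact h.choose_spec
  rw [h3.unique hB]
  exact ⟨hB, h1, h2⟩

theorem StronglyConnected.pinv_row_sum (hG : G.StronglyConnected) (hn : 2 ≤ n) (i : Fin n) :
    ∑ j, pinv G.laplacian i j = 0 := by
  obtain ⟨⟨-, h2, -, -⟩, h3, -⟩ := hG.pinv_spec hn
  rw [mul_assoc, h3, mul_sub, mul_one, sub_eq_self] at h2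
  have := congrFun (congrFun h2 i) i
  rw [mul_avg] at this
  have hn0 : (n : ℝ) ≠ 0 := by positivity
  simpa [hn0] using this

theorem StronglyConnected.pinv_col_sum (hG : G.StronglyConnected) (hn : 2 ≤ n) (j : Fin n) :
    ∑ i, pinv G.laplacian i j = 0 := by
  obtain ⟨⟨-, h2, -, -⟩, -, h3⟩ := hG.pinv_spec hn
  rw [h3, sub_mul, one_mul, sub_eq_self] at h2
  have := congrFun (congrFun h2 j) j
  rw [avg_mul] at this
  have hn0 : (n : ℝ) ≠ 0 := by positivity
  simpa [hn0] using this

/-- The difference of columns `j` and `v` of L† has the right Laplacian off `v`, since the two terms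
-1/n cancel; the constants make it vanish at `v`. -/
theorem StronglyConnected.green_singleton (hG : G.StronglyConnected) (hn : 2 ≤ n) (v i j : Fin n) :
    G.green {v} i j = pinv G.laplacian i j - pinv G.laplacian i v - pinv G.laplacian v j
      + pinv G.laplacian v v := by
  by_cases hj : j = v
  · subst hj
    rw [green_of_mem_right i (Finset.mem_singleton_self _)]
    ring
  have hmul : ∀ a b, ∑ l, G.laplacian a l * pinv G.laplacian l b =
      (1 : Matrix (Fin n) (Fin n) ℝ) a b - (n : ℝ)⁻¹ := fun a b =>
    congrFun (congrFun (hG.pinv_spec hn).2.1 a) b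
  refine hG.green_unique hn (Finset.singleton_nonempty v) (by simpa using hj)
    (x := fun i => pinv G.laplacian i j - pinv G.laplacian i v - pinv G.laplacian v j
      + pinv G.laplacian v v) (fun a ha => ?_) (fun a ha => ?_) i
  · rw [Finset.mem_singleton.1 ha]
    ring
  · have hav : a ≠ v := by simpa using ha
    simp only [mul_sub, mul_add, Finset.sum_sub_distrib, Finset.sum_add_distrib,
      ← Finset.sum_mul, hG.laplacian_row_sum hn, hmul, Matrix.one_apply, if_neg hav]
    ring

theorem StronglyConnected.sum_green_singleton (hG : G.StronglyConnected) (hn : 2 ≤ n)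
    (v : Fin n) :
    ∑ i, G.green {v} i i = n * pinv G.laplacian v v + (pinv G.laplacian).trace := by
  simp only [hG.green_singleton hn, Finset.sum_sub_distrib, Finset.sum_add_distrib,
    hG.pinv_row_sum hn, hG.pinv_col_sum hn, Matrix.trace, Matrix.diag]
  simp
  ring

/-- Summing over the absorbing vertex gives the same value as the trace with `v` absorbing, because
row and column sums of L† both vanish. This reconciles Ω(v) with Ω({v}). -/
theorem StronglyConnected.sum_green_singleton_left (hG : G.StronglyConnected) (hn : 2 ≤ n)
    (v : Fin n) :
    ∑ j, G.green {j} v v = n * pinv G.laplacian v v + (pinv G.laplacian).trace := by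
  simp only [hG.green_singleton hn, Finset.sum_sub_distrib, Finset.sum_add_distrib,
    hG.pinv_row_sum hn, hG.pinv_col_sum hn, Matrix.trace, Matrix.diag]
  simp

/-! ### The random walk and escape probabilities -/

instance (i : Fin n) : IsProbabilityMeasure (G.walkLaw i) := by
  unfold walkLaw
  infer_instance

theorem map_eval_zero_walkLaw (i : Fin n) :
    (G.walkLaw i).map (fun w => w 0) = Measure.dirac i := by
  have h : (fun w : ℕ → Fin n => w 0) =
      (MeasurableEquiv.piUnique fun _ : Finset.Iic 0 => Fin n) ∘ Preorder.frestrictLe 0 := rfl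
  have h2 : (G.walkLaw i).map (Preorder.frestrictLe 0) =
      (Measure.dirac i).map (MeasurableEquiv.piUnique fun _ : Finset.Iic 0 => Fin n).symm := by
    unfold walkLaw Kernel.trajMeasure
    rw [Measure.map_comp _ _ (by fun_prop), Kernel.traj_map_frestrictLe, Kernel.partialTraj_self,
      Measure.id_comp]
  rw [h, ← Measure.map_map (by fun_prop) (by fun_prop), h2, MeasurableEquiv.map_map_symm]

theorem walkLaw_real_zero (i j : Fin n) :
    (G.walkLaw i).real {w | w 0 = j} = if i = j then 1 else 0 := by
  have h : (G.walkLaw i).real {w | w 0 = j} =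
      ((G.walkLaw i).map (fun w => w 0)).real {j} := by
    rw [map_measureReal_apply (by fun_prop) (measurableSet_singleton j)]
    rfl
  rw [h, map_eval_zero_walkLaw, measureReal_def, Measure.dirac_apply]
  by_cases hij : i = j <;> simp [hij]

theorem StronglyConnected.stepKernel_apply (hG : G.StronglyConnected) (hn : 2 ≤ n)
    (l j : Fin n) : G.stepKernel l {j} = ENNReal.ofReal (G.P l j) := by
  change (G.stepLaw l).toMeasure {j} = _
  rw [PMF.toMeasure_apply_singleton _ _ (measurableSet_singleton j), stepLaw,
    dif_pos (hG.deg_pos hn l).ne']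
  rfl

/-- The Markov property of the random walk. -/
theorem StronglyConnected.walkLaw_real_markov (hG : G.StronglyConnected) (hn : 2 ≤ n)
    (i l j : Fin n) (t : ℕ) {S : Set (Finset.Iic t → Fin n)} (hS : MeasurableSet S) :
    (G.walkLaw i).real ({w | Preorder.frestrictLe t w ∈ S ∧ w t = l} ∩ {w | w (t + 1) = j}) =
      (G.walkLaw i).real {w | Preorder.frestrictLe t w ∈ S ∧ w t = l} * G.P l j := by
  set S' : Set (Finset.Iic t → Fin n) := S ∩ {x | x ⟨t, Finset.mem_Iic.2 le_rfl⟩ = l} with hS'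
  have hS'm : MeasurableSet S' :=
    hS.inter (measurableSet_eq_fun (measurable_pi_apply _) measurable_const)
  have key := congrArg (fun m => m (S' ×ˢ ({j} : Set (Fin n))))
    (Kernel.map_frestrictLe_trajMeasure_compProd_eq_map_trajMeasure
      (X := fun _ => Fin n) (κ := G.historyKernel) (μ₀ := Measure.dirac i) (a := t))
  beta_reduce at key
  rw [Measure.compProd_apply_prod hS'm (measurableSet_singleton j),
    Measure.map_apply (by fun_prop) (hS'm.prod (measurableSet_singleton j)),
    setLIntegral_congr_fun (g := fun _ => ENNReal.ofReal (G.P l j)) hS'm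
      (fun x hx => by
        change G.stepKernel (x ⟨t, _⟩) {j} = _
        rw [hx.2, hG.stepKernel_apply hn]),
    setLIntegral_const, Measure.map_apply (by fun_prop) hS'm] at key
  have key' := congrArg ENNReal.toReal key
  rw [ENNReal.toReal_mul, ENNReal.toReal_ofReal (P_nonneg _ _), mul_comm] at key'
  exact key'.symm

variable (n) in
/-- The walk avoids `Z` at the times `1, …, t`. -/
def avoids (Z : Finset (Fin n)) (t : ℕ) : Set (ℕ → Fin n) :=
  {w | ∀ s, 1 ≤ s → s ≤ t → w s ∉ Z}

variable (n) in
/-- The walk reaches `X` at one of the times `1, …, t`, before it returns to `i`. -/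
def reaches (i : Fin n) (X : Finset (Fin n)) (t : ℕ) : Set (ℕ → Fin n) :=
  {w | ∃ s, 1 ≤ s ∧ s ≤ t ∧ w s ∈ X ∧ ∀ r, 1 ≤ r → r < s → w r ≠ i}

variable (G) in
/-- The probability that the walk is at `l` at time `t`, having avoided `Z` since time `1`. -/
noncomputable def occupation (i : Fin n) (Z : Finset (Fin n)) (t : ℕ) (l : Fin n) : ℝ :=
  (G.walkLaw i).real (avoids n Z t ∩ {w | w t = l})

theorem measurableSet_eval_mem (t : ℕ) (s : Set (Fin n)) :
    MeasurableSet {w : ℕ → Fin n | w t ∈ s} :=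
  measurable_pi_apply t (MeasurableSet.of_discrete (s := s))

theorem measurableSet_avoids (Z : Finset (Fin n)) (t : ℕ) : MeasurableSet (avoids n Z t) := by
  simp only [avoids, Set.ofPred_forall]
  exact MeasurableSet.iInter fun s => MeasurableSet.iInter fun _ => MeasurableSet.iInter fun _ =>
    measurableSet_eval_mem s {a | a ∉ Z}

theorem occupation_nonneg (i : Fin n) (Z : Finset (Fin n)) (t : ℕ) (l : Fin n) :
    0 ≤ G.occupation i Z t l :=
  measureReal_nonneg

theorem measureReal_eq_sum_inter (μ : Measure (ℕ → Fin n)) [IsFiniteMeasure μ]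
    (A : Set (ℕ → Fin n)) (t : ℕ) (s : Finset (Fin n)) :
    μ.real (A ∩ {w | w t ∈ s}) = ∑ l ∈ s, μ.real (A ∩ {w | w t = l}) := by
  classical
  induction s using Finset.induction_on with
  | empty => simp
  | insert a s ha ih =>
    rw [Finset.sum_insert ha, ← ih, ← measureReal_inter_add_sdiff (s := A ∩ {w | w t ∈ insert a s})
      (measurableSet_eval_mem t {a})]
    congr 2
    · ext w
      simp only [Set.mem_inter_iff, Set.mem_ofPred_eq, Finset.mem_insert, Set.mem_singleton_iff]
      tauto
    · ext w
      simp only [Set.mem_inter_iff, Set.mem_ofPred_eq, Finset.mem_insert, Set.mem_singleton_iff,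
        Set.mem_sdiff]
      constructor
      · tauto
      · rintro ⟨h1, h2⟩
        exact ⟨⟨h1, Or.inr h2⟩, fun h => ha (h ▸ h2)⟩

theorem StronglyConnected.walkLaw_real_avoids_succ (hG : G.StronglyConnected) (hn : 2 ≤ n)
    (i : Fin n) (Z : Finset (Fin n)) (t : ℕ) (j : Fin n) :
    (G.walkLaw i).real (avoids n Z t ∩ {w | w (t + 1) = j}) =
      ∑ l, G.occupation i Z t l * G.P l j := by
  have h := measureReal_eq_sum_inter (G.walkLaw i) (avoids n Z t ∩ {w | w (t + 1) = j}) t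
    Finset.univ
  simp only [Finset.mem_univ, Set.ofPred_true, Set.inter_univ] at h
  rw [h]
  refine Finset.sum_congr rfl fun l _ => ?_
  set S : Set (Finset.Iic t → Fin n) :=
    {x | ∀ s : Finset.Iic t, 1 ≤ s.1 → x s ∉ Z} with hS
  have hSm : MeasurableSet S := MeasurableSet.of_discrete
  have hset : avoids n Z t ∩ {w | w t = l} =
      {w | Preorder.frestrictLe (π := fun _ => Fin n) t w ∈ S ∧ w t = l} := by
    ext w
    refine and_congr_left fun _ => ⟨fun h s hs => h s hs (Finset.mem_Iic.1 s.2), fun h s hs hst =>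
      h ⟨s, Finset.mem_Iic.2 hst⟩ hs⟩
  rw [occupation, hset, ← hG.walkLaw_real_markov hn i l j t hSm, ← hset, Set.inter_right_comm]

/-- Avoidance is only required from time 1 on, so the start counts even when it lies in `Z`, as it
does for `Z = insert i X`. -/
theorem occupation_zero (i : Fin n) (Z : Finset (Fin n)) (l : Fin n) :
    G.occupation i Z 0 l = if i = l then 1 else 0 := by
  rw [← walkLaw_real_zero (G := G) i l, occupation]
  congr 1
  refine Set.inter_eq_right.2 fun w _ s h1 h2 => ?_
  omega

theorem StronglyConnected.occupation_succ (hG : G.StronglyConnected) (hn : 2 ≤ n)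
    (i : Fin n) (Z : Finset (Fin n)) (t : ℕ) (j : Fin n) :
    G.occupation i Z (t + 1) j = if j ∈ Z then 0 else ∑ l, G.occupation i Z t l * G.P l j := by
  rw [occupation]
  split_ifs with hj
  · convert measureReal_empty
    refine Set.eq_empty_of_forall_notMem fun w hw => ?_
    have := hw.1 (t + 1) (by omega) le_rfl
    rw [hw.2] at this
    exact this hj
  · rw [← hG.walkLaw_real_avoids_succ hn]
    congr 1
    ext w
    refine and_congr_left fun hw => ⟨fun h s h1 h2 => h s h1 (by omega), fun h s h1 h2 => ?_⟩
    rcases Nat.lt_or_ge t s with h3 | h3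
    · obtain rfl : s = t + 1 := by omega
      rw [show w (t + 1) = j from hw]
      exact hj
    · exact h s h1 h3

/-- A success that is new at time `t + 1` means avoiding both `i` and `X` up to time `t` and then
stepping into `X`. -/
theorem StronglyConnected.walkLaw_real_reaches_succ (hG : G.StronglyConnected) (hn : 2 ≤ n)
    (i : Fin n) (X : Finset (Fin n)) (t : ℕ) :
    (G.walkLaw i).real (reaches n i X (t + 1)) = (G.walkLaw i).real (reaches n i X t) +
      ∑ x ∈ X, ∑ l, G.occupation i (insert i X) t l * G.P l x := by
  simp only [← hG.walkLaw_real_avoids_succ hn]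
  rw [← measureReal_eq_sum_inter, ← measureReal_union]
  · congr 1
    ext w
    constructor
    · rintro ⟨s, h1, h2, h3, h4⟩
      by_cases hr : w ∈ reaches n i X t
      · exact Or.inl hr
      obtain rfl : s = t + 1 := by
        by_contra hs
        exact hr ⟨s, h1, by omega, h3, h4⟩
      refine Or.inr ⟨fun r hr1 hr2 => ?_, h3⟩
      rw [Finset.mem_insert, not_or]
      exact ⟨h4 r hr1 (by omega), fun h5 => hr ⟨r, hr1, hr2, h5, fun q hq1 hq2 =>
        h4 q hq1 (by omega)⟩⟩
    · rintro (⟨s, h1, h2, h3, h4⟩ | ⟨h1, h2⟩)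
      · exact ⟨s, h1, by omega, h3, h4⟩
      · exact ⟨t + 1, by omega, le_rfl, h2, fun r hr1 hr2 h =>
          h1 r hr1 (by omega) (h ▸ Finset.mem_insert_self _ _)⟩
  · refine Set.disjoint_left.2 ?_
    rintro w ⟨s, h1, h2, h3, -⟩ ⟨h4, -⟩
    exact h4 s h1 h2 (Finset.mem_insert_of_mem h3)
  · exact (measurableSet_avoids _ _).inter (measurableSet_eval_mem _ (X : Set (Fin n)))

theorem tendsto_walkLaw_real_reaches (i : Fin n) (X : Finset (Fin n)) :
    Filter.Tendsto (fun t => (G.walkLaw i).real (reaches n i X t)) Filter.atTop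
      (nhds (G.escapeProb i X)) := by
  have hmono : Monotone (reaches n i X) := by
    rintro a b hab w ⟨s, h1, h2, h3⟩
    exact ⟨s, h1, h2.trans hab, h3⟩
  have hunion : ⋃ t, reaches n i X t =
      {w | ∃ t, 1 ≤ t ∧ w t ∈ X ∧ ∀ s, 1 ≤ s → s < t → w s ≠ i} := by
    ext w
    simp only [Set.mem_iUnion]
    exact ⟨fun ⟨t, s, h1, _, h3⟩ => ⟨s, h1, h3⟩, fun ⟨s, h1, h3⟩ => ⟨s, s, h1, le_rfl, h3⟩⟩
  rw [escapeProb, ← hunion]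
  exact (ENNReal.tendsto_toReal (measure_ne_top _ _)).comp (tendsto_measure_iUnion_atTop hmono)

theorem StronglyConnected.sum_occupation_mul_succ (hG : G.StronglyConnected) (hn : 2 ≤ n)
    (i : Fin n) (Z : Finset (Fin n)) (t : ℕ) {u : Fin n → ℝ} (hu : ∀ j ∈ Z, u j = 0) :
    ∑ j, G.occupation i Z (t + 1) j * u j =
      ∑ l, G.occupation i Z t l * ∑ j, G.P l j * u j := by
  have h : ∀ j, G.occupation i Z (t + 1) j * u j =
      ∑ l, G.occupation i Z t l * (G.P l j * u j) := fun j => by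
    rw [hG.occupation_succ hn]
    split_ifs with hj
    · simp [hu j hj]
    · simp only [Finset.sum_mul, mul_assoc]
  simp only [h, Finset.mul_sum]
  exact Finset.sum_comm

/-- The walk almost surely does not avoid a nonempty set forever. -/
theorem StronglyConnected.tendsto_occupation (hG : G.StronglyConnected) (hn : 2 ≤ n)
    (i : Fin n) {Z : Finset (Fin n)} (hZ : Z.Nonempty) (l : Fin n) :
    Filter.Tendsto (fun t => G.occupation i Z (t + 1) l) Filter.atTop (nhds 0) := by
  -- The expected time to hit `Z`: zero on `Z`, and off `Z` one step lowers its mean by exactly 1.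
  set u : Fin n → ℝ := fun a => ∑ b, G.green Z a b * (G.vol * G.stationary b) with hu
  have hwpos : ∀ b, 0 < G.vol * G.stationary b := fun b =>
    mul_pos (hG.vol_pos hn) (hG.stationary_pos hn b)
  have hu0 : ∀ a, 0 ≤ u a := fun a =>
    Finset.sum_nonneg fun b _ => mul_nonneg (hG.green_nonneg hn hZ a b) (hwpos b).le
  have huZ : ∀ a ∈ Z, u a = 0 := fun a ha => by simp [hu, green_of_mem_left ha]
  have hPu : ∀ a ∉ Z, ∑ j, G.P a j * u j = u a - 1 := fun a ha => by
    have h1 : ∑ j, G.laplacian a j * u j = G.vol * G.stationary a := by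
      have h2 : ∀ b, ∑ j, G.laplacian a j * (G.green Z j b * (G.vol * G.stationary b)) =
          if a = b then G.vol * G.stationary b else 0 := fun b => by
        simp only [← mul_assoc (G.laplacian a _), ← Finset.sum_mul]
        by_cases hb : b ∈ Z
        · have hab : a ≠ b := fun h => ha (h ▸ hb)
          simp [green_of_mem_right _ hb, hab]
        · rw [hG.laplacian_mul_green hn hZ ha hb]
          split_ifs <;> simp
      simp only [hu, Finset.mul_sum]
      rw [Finset.sum_comm]
      simp [h2]
    rw [sum_laplacian_mul] at h1
    have h3 := mul_left_cancel₀ (hwpos a).ne' (h1.trans (mul_one _).symm)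
    linarith
  -- Each step lowers the surviving mean of `u` by the surviving mass, so these masses are summable.
  -- Counting starts at time 1, when no mass is left on `Z`.
  have hstep : ∀ t, ∑ j, G.occupation i Z (t + 2) j * u j =
      ∑ j, G.occupation i Z (t + 1) j * u j - ∑ j, G.occupation i Z (t + 1) j := fun t => by
    rw [hG.sum_occupation_mul_succ hn i Z (t + 1) huZ, ← Finset.sum_sub_distrib]
    refine Finset.sum_congr rfl fun a _ => ?_
    by_cases ha : a ∈ Z
    · simp [hG.occupation_succ hn, ha]
    · rw [hPu a ha]
      ring
  have hpartial : ∀ T, ∑ t ∈ Finset.range T, ∑ j, G.occupation i Z (t + 1) j =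
      ∑ j, G.occupation i Z 1 j * u j - ∑ j, G.occupation i Z (T + 1) j * u j := fun T => by
    induction T with
    | zero => simp
    | succ T ih =>
      rw [Finset.sum_range_succ, ih, hstep]
      ring
  have hsum : Summable fun t => ∑ j, G.occupation i Z (t + 1) j := by
    refine summable_of_sum_range_le (c := ∑ j, G.occupation i Z 1 j * u j)
      (fun t => Finset.sum_nonneg fun j _ => occupation_nonneg _ _ _ _) fun T => ?_
    rw [hpartial]
    exact sub_le_self _ (Finset.sum_nonneg fun j _ =>
      mul_nonneg (occupation_nonneg _ _ _ _) (hu0 j))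
  exact squeeze_zero (fun t => occupation_nonneg _ _ _ _)
    (fun t => Finset.single_le_sum (f := fun j => G.occupation i Z (t + 1) j)
      (fun j _ => occupation_nonneg _ _ _ _) (Finset.mem_univ l)) hsum.tendsto_atTop_zero

/-- The escape probability is the expectation, after one step, of a function `h` that is one on
`X`, zero at `i`, and harmonic elsewhere. -/
theorem StronglyConnected.escapeProb_eq (hG : G.StronglyConnected) (hn : 2 ≤ n) {i : Fin n}
    {X : Finset (Fin n)} {h : Fin n → ℝ} (hX : ∀ j ∈ X, h j = 1) (hi : h i = 0) (hiX : i ∉ X)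
    (hh : ∀ a ∉ insert i X, ∑ j, G.P a j * h j = h a) :
    G.escapeProb i X = ∑ j, G.P i j * h j := by
  -- Optional stopping: mass entering `X` is credited with `h = 1`, mass returning to `i` with `h =
  -- 0`.
  have hstep : ∀ t, (G.walkLaw i).real (reaches n i X (t + 1)) +
      ∑ j, G.occupation i (insert i X) (t + 1) j * h j =
      (G.walkLaw i).real (reaches n i X t) +
        ∑ l, G.occupation i (insert i X) t l * ∑ j, G.P l j * h j := fun t => by
    have hsplit : ∀ l, ∑ j, G.P l j * h j = (∑ x ∈ X, G.P l x) +
        ∑ j, G.P l j * (if j ∈ X then 0 else h j) := fun l => by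
      rw [← Finset.sum_filter_add_sum_filter_not Finset.univ (· ∈ X)]
      congr 1
      · rw [Finset.filter_univ_mem]
        exact Finset.sum_congr rfl fun x hx => by rw [hX x hx, mul_one]
      · rw [Finset.sum_filter]
        refine Finset.sum_congr rfl fun j _ => ?_
        by_cases hj : j ∈ X <;> simp [hj]
    have h1 : ∑ j, G.occupation i (insert i X) (t + 1) j * h j =
        ∑ j, G.occupation i (insert i X) (t + 1) j * (if j ∈ X then 0 else h j) :=
      Finset.sum_congr rfl fun j _ => by
        by_cases hj : j ∈ X
        · simp [hG.occupation_succ hn, hj]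
        · simp [hj]
    rw [h1, hG.sum_occupation_mul_succ hn i (insert i X) t (u := fun j => if j ∈ X then 0 else h j)
      (fun j hj => by
        rcases Finset.mem_insert.1 hj with rfl | hj
        · simp [hi]
        · simp [hj]), hG.walkLaw_real_reaches_succ hn]
    simp only [hsplit, mul_add, Finset.sum_add_distrib]
    rw [Finset.sum_comm (s := X)]
    simp only [Finset.mul_sum]
    ring
  -- The balance is constant only from time 1 on, since `h` need not be harmonic at the start `i`;
  -- its value there is the one-step mean.
  have hinv : ∀ t, (G.walkLaw i).real (reaches n i X (t + 1)) +
      ∑ j, G.occupation i (insert i X) (t + 1) j * h j = ∑ j, G.P i j * h j := fun t => by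
    induction t with
    | zero =>
      rw [hstep]
      have h0 : reaches n i X 0 = ∅ := by
        refine Set.eq_empty_of_forall_notMem ?_
        rintro w ⟨s, h1, h2, -⟩
        omega
      simp [h0, occupation_zero]
    | succ t ih =>
      rw [hstep, ← ih]
      congr 1
      refine Finset.sum_congr rfl fun a _ => ?_
      by_cases ha : a ∈ insert i X
      · rw [hG.occupation_succ hn, if_pos ha, zero_mul, zero_mul]
      · rw [hh a ha]
  have hlim1 := (tendsto_walkLaw_real_reaches (G := G) i X).comp (Filter.tendsto_add_atTop_nat 1)
  have hlim2 : Filter.Tendsto (fun t => ∑ j, G.occupation i (insert i X) (t + 1) j * h j)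
      Filter.atTop (nhds (∑ j, 0 * h j)) :=
    tendsto_finsetSum _ fun j _ =>
      (hG.tendsto_occupation hn i (Finset.insert_nonempty i X) j).mul_const _
  have hlim := hlim1.add hlim2
  simp only [Function.comp_apply, hinv, zero_mul, Finset.sum_const_zero, add_zero] at hlim
  exact tendsto_nhds_unique hlim tendsto_const_nhds

theorem StronglyConnected.escapeProb_mul_green (hG : G.StronglyConnected) (hn : 2 ≤ n) {i : Fin n}
    {X : Finset (Fin n)} (hX : X.Nonempty) (hi : i ∉ X) :
    G.vol * G.stationary i * G.escapeProb i X * G.green X i i = 1 := by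
  have hii := (hG.green_self_pos hn hX hi).ne'
  have hP : ∀ a, ∑ j, G.P a j * (1 - G.green X j i / G.green X i i) =
      1 - (∑ j, G.P a j * G.green X j i) / G.green X i i := fun a => by
    simp only [mul_sub, mul_one, Finset.sum_sub_distrib, hG.sum_P hn, ← mul_div_assoc,
      Finset.sum_div]
  have h1 := fun a (ha : a ∉ X) => hG.laplacian_mul_green hn hX ha hi
  simp only [sum_laplacian_mul] at h1
  rw [hG.escapeProb_eq hn (h := fun j => 1 - G.green X j i / G.green X i i)
    (fun j hj => by simp [green_of_mem_left hj]) (by simp [hii]) hi (fun a ha => ?_), hP]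
  · have h2 := h1 i hi
    rw [if_pos rfl] at h2
    rwa [mul_assoc, sub_mul, one_mul, div_mul_cancel₀ _ hii]
  · rw [Finset.mem_insert, not_or] at ha
    have h2 := h1 a ha.2
    rw [if_neg ha.1, mul_eq_zero, sub_eq_zero] at h2
    rw [hP]
    rcases h2 with h2 | h2
    · exact absurd h2 (mul_pos (hG.vol_pos hn) (hG.stationary_pos hn a)).ne'
    · rw [h2]

/-! ### Monotonicity and supermodularity of the resistance distance -/

theorem StronglyConnected.resistanceTo_eq_green (hG : G.StronglyConnected) (hn : 2 ≤ n)
    {X : Finset (Fin n)} (hX : X.Nonempty) (i : Fin n) : G.resistanceTo i X = G.green X i i := by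
  rw [resistanceTo]
  split_ifs with hi
  · rw [green_of_mem_left hi]
  · have h := hG.escapeProb_mul_green hn hX hi
    exact (eq_one_div_of_mul_eq_one_right h).symm

theorem StronglyConnected.resistance_eq_green (hG : G.StronglyConnected) (hn : 2 ≤ n)
    (i j : Fin n) : G.resistance i j = G.green {j} i i := by
  rw [← hG.resistanceTo_eq_green hn (Finset.singleton_nonempty j)]
  simp [resistance, resistanceTo]

theorem StronglyConnected.groupResistance_eq (hG : G.StronglyConnected) (hn : 2 ≤ n)
    {X : Finset (Fin n)} (hX : X.Nonempty) : G.groupResistance X = ∑ i, G.green X i i :=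
  Finset.sum_congr rfl fun i _ => hG.resistanceTo_eq_green hn hX i

theorem StronglyConnected.groupResistance_singleton_eq_pinv (hG : G.StronglyConnected)
    (hn : 2 ≤ n) (v : Fin n) : G.groupResistance {v} =
      n * pinv G.laplacian v v + (pinv G.laplacian).trace := by
  rw [hG.groupResistance_eq hn (Finset.singleton_nonempty v), hG.sum_green_singleton hn]

theorem StronglyConnected.vertexResistance_eq (hG : G.StronglyConnected) (hn : 2 ≤ n)
    (v : Fin n) : G.vertexResistance v = G.groupResistance {v} := by
  rw [hG.groupResistance_singleton_eq_pinv hn, ← hG.sum_green_singleton_left hn]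
  exact Finset.sum_congr rfl fun j _ => hG.resistance_eq_green hn v j

theorem StronglyConnected.groupResistance_insert_le (hG : G.StronglyConnected) (hn : 2 ≤ n)
    {X : Finset (Fin n)} (hX : X.Nonempty) (v : Fin n) :
    G.groupResistance (insert v X) ≤ G.groupResistance X := by
  rw [hG.groupResistance_eq hn hX, hG.groupResistance_eq hn (Finset.insert_nonempty v X)]
  exact Finset.sum_le_sum fun i _ => hG.green_insert_le hn hX v i i

theorem StronglyConnected.groupResistance_union_le (hG : G.StronglyConnected) (hn : 2 ≤ n)
    {X : Finset (Fin n)} (hX : X.Nonempty) (Y : Finset (Fin n)) :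
    G.groupResistance (X ∪ Y) ≤ G.groupResistance X := by
  induction Y using Finset.induction_on with
  | empty => simp
  | insert y Y _ ih =>
    rw [Finset.union_insert]
    exact (hG.groupResistance_insert_le hn (hX.mono Finset.subset_union_left) y).trans ih

variable (G) in
/-- The decrease of the resistance distance when `v` is added to the vertex group `X`. -/
noncomputable def resistanceDrop (X : Finset (Fin n)) (v : Fin n) : ℝ :=
  G.groupResistance X - G.groupResistance (insert v X)

theorem StronglyConnected.resistanceDrop_eq (hG : G.StronglyConnected) (hn : 2 ≤ n)
    {X : Finset (Fin n)} (hX : X.Nonempty) {v : Fin n} (hv : v ∉ X) :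
    G.resistanceDrop X v = ∑ i, G.green X v i * (G.green X i v / G.green X v v) := by
  rw [resistanceDrop, hG.groupResistance_eq hn hX,
    hG.groupResistance_eq hn (Finset.insert_nonempty v X), ← Finset.sum_sub_distrib]
  refine Finset.sum_congr rfl fun i _ => ?_
  rw [hG.green_insert hn hX hv]
  ring

theorem StronglyConnected.gain_eq_resistanceDrop (hG : G.StronglyConnected) (hn : 2 ≤ n)
    {X : Finset (Fin n)} (hX : X.Nonempty) (v : {u // u ∉ X}) :
    Exact.gain (Exact.removed G.laplacian X)⁻¹ v = G.resistanceDrop X v := by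
  rw [gain_inv_removed, hG.resistanceDrop_eq hn hX v.2, Finset.sum_div]
  exact Finset.sum_congr rfl fun i _ => mul_div_assoc _ _ _

theorem StronglyConnected.resistanceDrop_nonneg (hG : G.StronglyConnected) (hn : 2 ≤ n)
    {X : Finset (Fin n)} (hX : X.Nonempty) (v : Fin n) : 0 ≤ G.resistanceDrop X v :=
  sub_nonneg.2 (hG.groupResistance_insert_le hn hX v)

theorem resistanceDrop_of_mem {X : Finset (Fin n)} {v : Fin n} (hv : v ∈ X) :
    G.resistanceDrop X v = 0 := by
  rw [resistanceDrop, Finset.insert_eq_of_mem hv, sub_self]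

/-- The resistance distance of a vertex group is supermodular. -/
theorem StronglyConnected.resistanceDrop_insert_le (hG : G.StronglyConnected) (hn : 2 ≤ n)
    {X : Finset (Fin n)} (hX : X.Nonempty) (u v : Fin n) :
    G.resistanceDrop (insert u X) v ≤ G.resistanceDrop X v := by
  by_cases hv : v ∈ insert u X
  · rw [resistanceDrop_of_mem hv]
    exact hG.resistanceDrop_nonneg hn hX v
  by_cases hu : u ∈ X
  · rw [Finset.insert_eq_of_mem hu]
  have hvX : v ∉ X := fun h => hv (Finset.mem_insert_of_mem h)
  rw [hG.resistanceDrop_eq hn (Finset.insert_nonempty u X) hv, hG.resistanceDrop_eq hn hX hvX]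
  refine Finset.sum_le_sum fun i _ => ?_
  have h0 := hG.green_nonneg hn hX
  have h0' := hG.green_nonneg hn (Finset.insert_nonempty u X)
  -- What remains is that `green X i v / green X v v`, the probability of hitting `v` from `i`
  -- before `X`, does not grow with `X`.
  refine mul_le_mul (hG.green_insert_le hn hX u v i) ?_
    (div_nonneg (h0' _ _) (h0' _ _)) (h0 _ _)
  have huu := hG.green_self_pos hn hX hu
  have hvv := hG.green_self_pos hn hX hvX
  rw [div_le_div_iff₀ (hG.green_self_pos hn (Finset.insert_nonempty u X) hv) hvv,
    hG.green_insert hn hX hu, hG.green_insert hn hX hu]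
  -- Nonnegativity after `v` is added reads G(i,v) G(v,u) ≤ G(i,u) G(v,v) for G = `green X`; scaled
  -- by G(u,v)/G(u,u), it is the cross-multiplied claim.
  have h1 := hG.green_nonneg hn (Finset.insert_nonempty v X) i u
  rw [hG.green_insert hn hX hvX, sub_nonneg, div_le_iff₀ hvv] at h1
  have h2 := div_le_div_of_nonneg_right (mul_le_mul_of_nonneg_right h1 (h0 u v)) huu.le
  have h3 : G.green X i v * G.green X v u * G.green X u v / G.green X u u =
    G.green X i v * (G.green X v u * G.green X u v / G.green X u u) := by ring
  have h4 : G.green X i u * G.green X v v * G.green X u v / G.green X u u =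
    G.green X i u * G.green X u v / G.green X u u * G.green X v v := by ring
  rw [h3, h4] at h2
  rw [sub_mul, mul_sub]
  linarith

theorem StronglyConnected.resistanceDrop_union_le (hG : G.StronglyConnected) (hn : 2 ≤ n)
    {X : Finset (Fin n)} (hX : X.Nonempty) (Y : Finset (Fin n)) (v : Fin n) :
    G.resistanceDrop (X ∪ Y) v ≤ G.resistanceDrop X v := by
  induction Y using Finset.induction_on with
  | empty => simp
  | insert y Y _ ih =>
    rw [Finset.union_insert]
    exact (hG.resistanceDrop_insert_le hn (hX.mono Finset.subset_union_left) y v).trans ih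

theorem StronglyConnected.groupResistance_sub_union_le (hG : G.StronglyConnected) (hn : 2 ≤ n)
    {X : Finset (Fin n)} (hX : X.Nonempty) {d : ℝ} (hd : ∀ v, G.resistanceDrop X v ≤ d)
    (Y : Finset (Fin n)) :
    G.groupResistance X - G.groupResistance (X ∪ Y) ≤ Y.card * d := by
  induction Y using Finset.induction_on with
  | empty => simp
  | insert y Y hy ih =>
    rw [Finset.union_insert, Finset.card_insert_of_notMem hy]
    have h := (hG.resistanceDrop_union_le hn hX Y y).trans (hd y)
    rw [resistanceDrop] at h
    push_cast
    linarith

/-! ### The greedy algorithm -/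

/-- A greedy step reduces the distance to the optimum by the factor `1 - 1 / k`. -/
theorem StronglyConnected.groupResistance_greedy_step (hG : G.StronglyConnected) (hn : 2 ≤ n)
    {X Y : Finset (Fin n)} (hX : X.Nonempty) (hY : Y.Nonempty) {k : ℕ} (hYk : Y.card ≤ k)
    {v : Fin n} (hv : ∀ u ∉ X, G.resistanceDrop X u ≤ G.resistanceDrop X v) :
    G.groupResistance (insert v X) - G.groupResistance Y ≤
      (1 - 1 / (k : ℝ)) * (G.groupResistance X - G.groupResistance Y) := by
  have hd0 := hG.resistanceDrop_nonneg hn hX v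
  have hd : ∀ u, G.resistanceDrop X u ≤ G.resistanceDrop X v := fun u => by
    by_cases hu : u ∈ X
    · rwa [resistanceDrop_of_mem hu]
    · exact hv u hu
  have h1 := hG.groupResistance_sub_union_le hn hX hd Y
  -- The total drop from `X` to `X ∪ Y` is at least the gap to `Y`, so the best single drop is at
  -- least a `1 / k` share of that gap.
  have h2 := hG.groupResistance_union_le hn hY X
  rw [Finset.union_comm] at h2
  have h3 : (Y.card : ℝ) * G.resistanceDrop X v ≤ k * G.resistanceDrop X v :=
    mul_le_mul_of_nonneg_right (Nat.cast_le.2 hYk) hd0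
  have hk : (0 : ℝ) < k := Nat.cast_pos.2 (hY.card_pos.trans_le hYk)
  have h4 : 1 / (k : ℝ) * (G.groupResistance X - G.groupResistance Y) ≤ G.resistanceDrop X v := by
    rw [one_div_mul_eq_div, div_le_iff₀' hk]
    linarith
  rw [resistanceDrop] at h4
  linarith

theorem StronglyConnected.state_invariant (hG : G.StronglyConnected) (hn : 2 ≤ n) {i : ℕ}
    {X : Finset (Fin n)} {M : Matrix {u // u ∉ X} {u // u ∉ X} ℝ}
    (h : Exact.State G.laplacian i X M) :
    X.Nonempty ∧ X.card = i ∧ M = (Exact.removed G.laplacian X)⁻¹ := by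
  induction h with
  | init v hv => exact ⟨Finset.singleton_nonempty v, Finset.card_singleton v, rfl⟩
  | step h v hv ih =>
    obtain ⟨h1, h2, rfl⟩ := ih
    exact ⟨Finset.insert_nonempty _ _, by rw [Finset.card_insert_of_notMem v.2, h2],
      hG.update_inv_removed hn h1 v⟩

theorem StronglyConnected.state_bound (hG : G.StronglyConnected) (hn : 2 ≤ n) {vs : Fin n}
    {Y : Finset (Fin n)} (hY : Y.Nonempty) {k : ℕ} (hYk : Y.card ≤ k) {i : ℕ}
    {X : Finset (Fin n)} {M : Matrix {u // u ∉ X} {u // u ∉ X} ℝ}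
    (h : Exact.State G.laplacian i X M) :
    G.groupResistance X - G.groupResistance Y ≤
      (1 - 1 / (k : ℝ)) ^ (i - 1) * (G.groupResistance {vs} - G.groupResistance Y) := by
  induction h with
  | init v hv =>
    -- The first selection minimizes Ω({v}), so the bound starts from any comparison vertex `vs`.
    have := hv vs
    rw [← hG.groupResistance_singleton_eq_pinv hn, ← hG.groupResistance_singleton_eq_pinv hn]
      at this
    simpa using this
  | @step i X M h v hv ih =>
    obtain ⟨h1, h2, rfl⟩ := hG.state_invariant hn h
    have hi : 1 ≤ i := h2 ▸ h1.card_pos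
    have hk : (1 : ℝ) ≤ k := Nat.one_le_cast.2 (hY.card_pos.trans_le hYk)
    refine (hG.groupResistance_greedy_step hn h1 hY hYk fun u hu => ?_).trans ?_
    · rw [← hG.gain_eq_resistanceDrop hn h1 v, ← hG.gain_eq_resistanceDrop hn h1 ⟨u, hu⟩]
      exact hv _
    · have h3 : 0 ≤ 1 - 1 / (k : ℝ) := sub_nonneg.2 (div_le_one_of_le₀ hk (by linarith))
      calc _ ≤ (1 - 1 / (k : ℝ)) * ((1 - 1 / (k : ℝ)) ^ (i - 1) *
              (G.groupResistance {vs} - G.groupResistance Y)) := mul_le_mul_of_nonneg_left ih h3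
        _ = _ := by rw [← mul_assoc, ← pow_succ', Nat.sub_add_cancel hi, Nat.add_sub_cancel]

theorem StronglyConnected.exists_state (hG : G.StronglyConnected) (hn : 2 ≤ n) {i : ℕ}
    (hi : 1 ≤ i) (hin : i ≤ n) : ∃ X M, Exact.State G.laplacian i X M := by
  induction i, hi using Nat.le_induction with
  | base =>
    have : Nonempty (Fin n) := ⟨⟨0, by omega⟩⟩
    obtain ⟨v, hv⟩ := Finite.exists_min
      fun v => n * pinv G.laplacian v v + (pinv G.laplacian).trace
    exact ⟨_, _, .init v hv⟩
  | succ i hi ih =>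
    obtain ⟨X, M, h⟩ := ih (by omega)
    obtain ⟨-, h2, -⟩ := hG.state_invariant hn h
    obtain ⟨a, ha⟩ : ∃ a, a ∉ X := by
      by_contra! hall
      have := Finset.card_eq_of_equiv_fin ((Equiv.subtypeUnivEquiv hall))
      omega
    have : Nonempty {u // u ∉ X} := ⟨⟨a, ha⟩⟩
    obtain ⟨v, hv⟩ := Finite.exists_max (Exact.gain M)
    exact ⟨_, _, .step h v hv⟩

end WeightedDigraph

theorem one_sub_one_div_pow_pred_le {k : ℕ} (hk : 2 ≤ k) :
    (1 - 1 / (k : ℝ)) ^ (k - 1) ≤ (k : ℝ) / ((k : ℝ) - 1) * (1 / Real.exp 1) := by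
  have hk' : (2 : ℝ) ≤ k := by exact_mod_cast hk
  have h1 := Real.one_sub_div_pow_le_exp_neg (n := k) (t := 1) (by linarith)
  rw [Real.exp_neg, ← one_div] at h1
  -- Only k - 1 steps contract; the missing factor 1 - 1/k is what produces k/(k - 1).
  have h2 : (1 - 1 / (k : ℝ)) ^ (k - 1) =
      (k : ℝ) / ((k : ℝ) - 1) * (1 - 1 / (k : ℝ)) ^ k := by
    have h3 : (k : ℝ) - 1 ≠ 0 := by linarith
    have h4 : (k : ℝ) ≠ 0 := by linarith
    rw [← Nat.sub_add_cancel (show 1 ≤ k by omega), pow_succ, Nat.sub_add_cancel (by omega)]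
    have h5 : (k : ℝ) / ((k : ℝ) - 1) * (1 - 1 / (k : ℝ)) = 1 := by
      field_simp
    rw [mul_left_comm, h5, mul_one]
  rw [h2]
  exact mul_le_mul_of_nonneg_left h1 (div_nonneg (by linarith) (by linarith))

theorem mainTheorem9 (n k : ℕ) (hk : 2 ≤ k) (hkn : k ≤ n)
    (G : WeightedDigraph n) (hG : G.StronglyConnected)
    (vs : Fin n) (hvs : ∀ v, G.vertexResistance vs ≤ G.vertexResistance v)
    (Xs : Finset (Fin n))
    (hXs : (Xs.card = k ∧ ∀ Y : Finset (Fin n), Y.card = k →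
        G.groupResistance Xs ≤ G.groupResistance Y) ∨
      (Xs.Nonempty ∧ Xs.card ≤ k ∧ ∀ Y : Finset (Fin n), Y.Nonempty → Y.card ≤ k →
        G.groupResistance Xs ≤ G.groupResistance Y)) :
    (∃ X, Exact.Returns G.laplacian k X) ∧
    ∀ X, Exact.Returns G.laplacian k X →
      X.card = k ∧
      G.vertexResistance vs - G.groupResistance X ≥
        (1 - (k : ℝ) / ((k : ℝ) - 1) * (1 / Real.exp 1)) *
          (G.vertexResistance vs - G.groupResistance Xs) := by
  have hn : 2 ≤ n := hk.trans hkn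
  simp only [hG.vertexResistance_eq hn]
  obtain ⟨hne, hle, hopt⟩ : Xs.Nonempty ∧ Xs.card ≤ k ∧
      G.groupResistance Xs ≤ G.groupResistance {vs} := by
    rcases hXs with ⟨hc, h⟩ | ⟨h0, hc, h⟩
    · refine ⟨Finset.card_pos.1 (by omega), hc.le, ?_⟩
      -- The singleton does not compete among the k-element sets, so it is enlarged to one, which
      -- does not increase Ω.
      obtain ⟨Y, hY, hYk⟩ := Finset.exists_superset_card_eq (s := {vs}) (n := k)
        (by rw [Finset.card_singleton]; omega) (by rwa [Fintype.card_fin])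
      refine (h Y hYk).trans ?_
      rw [← Finset.union_eq_right.2 hY]
      exact hG.groupResistance_union_le hn (Finset.singleton_nonempty vs) Y
    · exact ⟨h0, hc, h _ (Finset.singleton_nonempty vs) (by rw [Finset.card_singleton]; omega)⟩
  refine ⟨hG.exists_state hn (by omega) hkn, ?_⟩
  rintro X ⟨M, h⟩
  refine ⟨(hG.state_invariant hn h).2.1, ?_⟩
  have h1 := hG.state_bound hn (vs := vs) hne hle h
  -- Replacing the power by its upper bound needs a nonnegative initial gap, which is `hopt`.
  have h2 := mul_le_mul_of_nonneg_right (one_sub_one_div_pow_pred_le hk) (sub_nonneg.2 hopt)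
  rw [ge_iff_le, sub_mul, one_mul]
  linarith
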